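/- Notation. For $f\in L^2(\mathbb R)$, $\widehat f$ is its Fourier transform (the unitary extension to $L^2(\mathbb R)$ of $\widehat f(\gamma)=\int_{\mathbb R} f(x)e^{-2\pi i x\gamma}\,dx$), and $T_kf(x)=f(x-k)$ for $k\in\mathbb Z$. A family $\{f_k\}_{k\in\mathbb Z}$ in a closed subspace $\mathcal W\subseteq L^2(\mathbb R)$ is a frame for $\mathcal W$ if there are constants $0<\alpha\le\beta<\infty$ with $\alpha\|f\|^2\le\sum_k|\langle f,f_k\rangle|^2\le\beta\|f\|^2$ for all $f\in\mathcal W$. For such a family $\mathcal F=\{f_k\}$, let $T_{\mathcal F}:\ell^2(\mathbb Z)\to L^2(\mathbb R)$, $T_{\mathcal F}(c_k)=\sum_k c_kf_k$, so that $T_{\mathcal F}^*f=(\langle f,f_k\rangle)_k$. Let $\mathcal W,\mathcal V$ be closed subspaces of $L^2(\mathbb R)$ with $L^2(\mathbb R)=\mathcal W\oplus\mathcal V^\perp$ (equivalently, $L^2(\mathbb R)=\mathcal V\oplus\mathcal W^\perp$). Let $\pi_{\mathcal W\mathcal V^\perp}$ be the projection onto $\mathcal W$ along $\mathcal V^\perp$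 and $\pi_{\mathcal V\mathcal W^\perp}$ the projection onto $\mathcal V$ along $\mathcal W^\perp$. For $\varepsilon\ge 0$, frames $\mathcal F$ for $\mathcal W$ and $\mathcal G$ for $\mathcal V$ are called $\varepsilon$-approximate oblique dual frames if $\|\pi_{\mathcal W\mathcal V^\perp}-T_{\mathcal F}T_{\mathcal G}^*\|\le\varepsilon$ or $\|\pi_{\mathcal V\mathcal W^\perp}-T_{\mathcal G}T_{\mathcal F}^*\|\le\varepsilon$. Statement. Let $\phi,\phi_1\in L^2(\mathbb R)$ be such that $\{T_k\phi\}_{k\in\mathbb Z}$ is a frame for $\mathcal W$ and $\{T_k\phi_1\}_{k\in\mathbb Z}$ is a frame for $\mathcal V$. Let $\tilde\phi\in\mathcal V$ satisfy $\widehat{\tilde\phi}=\tilde H\,\widehat{\phi_1}$ a.e. on $\mathbb R$, where $\tilde H\in L^2(0,1)$ is extended $1$-periodically to $\mathbb R$. Let $0\le\varepsilon<1$ and $\Phi(\gamma)=\sum_{n\in\mathbb Z}|\widehat\phi(\gamma+n)|^2$ for $\gamma\in[0,1]$. If $$\Bigl|\overline{\tilde H(\gamma)}\sum_{n\in\mathbb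 Z}\widehat\phi(\gamma+n)\overline{\widehat{\phi_1}(\gamma+n)}-1\Bigr|\le\frac{\varepsilon}{\|\pi_{\mathcal W\mathcal V^\perp}\|}\quad\text{for a.e. }\gamma\in\{\gamma\in[0,1]:\Phi(\gamma)\ne0\},$$ then $\{T_k\tilde\phi\}_{k\in\mathbb Z}$ is a frame for $\mathcal V$, and $\{T_k\phi\}_{k\in\mathbb Z}$ and $\{T_k\tilde\phi\}_{k\in\mathbb Z}$ are $\varepsilon$-approximate oblique dual frames. -/

import Mathlib

open MeasureTheory FourierTransform
open scoped ENNReal InnerProductSpace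

noncomputable section

namespace ObliqueFrames

section Hilbert

variable {H : Type*} [NormedAddCommGroup H] [InnerProductSpace ℂ H] [CompleteSpace H]
variable {ι : Type*}

/-- `f` is a Bessel sequence in the whole Hilbert space. Mathlib's `⟪x, y⟫_ℂ` is linear in `y`, so
`⟪f k, x⟫_ℂ` is the coefficient of `x` along `f k` (linear in `x`). -/
def IsBessel (f : ι → H) : Prop :=
  ∃ β : ℝ, ∀ x : H, Summable (fun k => ‖⟪f k, x⟫_ℂ‖ ^ 2) ∧
    ∑' k, ‖⟪f k, x⟫_ℂ‖ ^ 2 ≤ β * ‖x‖ ^ 2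

/-- `f` is a frame for the subspace `W`: its members lie in `W` and there are frame bounds
`0 < α ≤ β < ∞`. -/
structure IsFrame (W : Submodule ℂ H) (f : ι → H) : Prop where
  mem : ∀ k, f k ∈ W
  bounds : ∃ α β : ℝ, 0 < α ∧ α ≤ β ∧ ∀ x ∈ W,
    Summable (fun k => ‖⟪f k, x⟫_ℂ‖ ^ 2) ∧
    α * ‖x‖ ^ 2 ≤ ∑' k, ‖⟪f k, x⟫_ℂ‖ ^ 2 ∧
    ∑' k, ‖⟪f k, x⟫_ℂ‖ ^ 2 ≤ β * ‖x‖ ^ 2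

/-- A frame for a closed subspace is a Bessel sequence in the whole space. -/
theorem IsFrame.isBessel {W : Submodule ℂ H} {f : ι → H} (hW : IsClosed (W : Set H))
    (hf : IsFrame W f) : IsBessel f := by
  obtain ⟨α, β, hα, hαβ, h⟩ := hf.bounds
  have : CompleteSpace W := hW.completeSpace_coe
  refine ⟨β, fun x => ?_⟩
  have key : ∀ k, ⟪f k, x⟫_ℂ = ⟪f k, W.starProjection x⟫_ℂ := by
    intro k
    rw [← W.inner_starProjection_left_eq_right,
      Submodule.starProjection_eq_self_iff.mpr (hf.mem k)]
  obtain ⟨h1, -, h3⟩ := h (W.starProjection x) (W.starProjection_apply_mem x)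
  simp only [key]
  refine ⟨h1, h3.trans ?_⟩
  have := W.norm_starProjection_apply_le x
  have hβ : 0 ≤ β := hα.le.trans hαβ
  gcongr

/-- The analysis operator `x ↦ (⟨x, f k⟩)ₖ` of a Bessel sequence. -/
def analysis (f : ι → H) (hf : IsBessel f) : H →L[ℂ] lp (fun _ : ι => ℂ) 2 :=
  LinearMap.mkContinuousOfExistsBound
    { toFun := fun x => ⟨fun k => ⟪f k, x⟫_ℂ, by
        obtain ⟨β, h⟩ := hf
        exact memℓp_gen (by simpa using (h x).1)⟩
      map_add' := fun x y => by
        ext k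
        exact inner_add_right _ _ _
      map_smul' := fun c x => by
        ext k
        exact inner_smul_right _ _ _ }
    (by
      obtain ⟨β, h⟩ := hf
      refine ⟨√β, fun x => ?_⟩
      have h2 := (h x).2
      have h0 : 0 ≤ β * ‖x‖ ^ 2 := (tsum_nonneg fun k => by positivity).trans h2
      rw [lp.norm_eq_tsum_rpow (by norm_num)]
      simp only [ENNReal.toReal_ofNat, Real.rpow_ofNat]
      rw [← Real.sqrt_eq_rpow]
      refine (Real.sqrt_le_sqrt h2).trans (le_of_eq ?_)
      rw [Real.sqrt_mul' _ (by positivity), Real.sqrt_sq (norm_nonneg x)])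

theorem analysis_apply (f : ι → H) (hf : IsBessel f) (x : H) (k : ι) :
    analysis f hf x k = ⟪f k, x⟫_ℂ := rfl

/-- The synthesis operator `(cₖ)ₖ ↦ ∑ₖ cₖ f k` of a Bessel sequence, obtained as the adjoint of
the analysis operator; see `hasSum_synthesis` for the series. -/
def synthesis (f : ι → H) (hf : IsBessel f) : lp (fun _ : ι => ℂ) 2 →L[ℂ] H :=
  ContinuousLinearMap.adjoint (analysis f hf)

theorem hasSum_synthesis (f : ι → H) (hf : IsBessel f) (c : lp (fun _ : ι => ℂ) 2) :
    HasSum (fun k => c k • f k) (synthesis f hf c) := by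
  classical
  have h := (lp.hasSum_single (p := 2) (by norm_num) c).mapL (synthesis f hf)
  convert h using 2 with k
  refine ext_inner_right ℂ fun x => ?_
  rw [synthesis, ContinuousLinearMap.adjoint_inner_left, lp.inner_single_left, analysis_apply,
    inner_smul_left]
  simp [mul_comm]

theorem isTopCompl_of_isCompl {W V : Submodule ℂ H} (hW : IsClosed (W : Set H))
    (h : IsCompl W Vᗮ) : Submodule.IsTopCompl W Vᗮ :=
  Submodule.isTopCompl_iff_isCompl_isClosed.mpr ⟨h, hW, V.isClosed_orthogonal⟩

/-- The oblique projection onto `W` along `Vᗮ`, where `W` is closed and `H = W ⊕ Vᗮ`. -/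
def obliqueProj (W V : Submodule ℂ H) (hW : IsClosed (W : Set H)) (h : IsCompl W Vᗮ) :
    H →L[ℂ] H :=
  W.projectionL Vᗮ (isTopCompl_of_isCompl hW h)

/-- For closed subspaces, `H = W ⊕ Vᗮ` implies `H = V ⊕ Wᗮ`. -/
theorem isCompl_swap {W V : Submodule ℂ H} (hW : IsClosed (W : Set H))
    (hV : IsClosed (V : Set H)) (h : IsCompl W Vᗮ) : IsCompl V Wᗮ := by
  have : CompleteSpace V := hV.completeSpace_coe
  set P := obliqueProj W V hW h with hP
  have hPW : ∀ w ∈ W, P w = w := fun w hw =>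
    Submodule.projectionL_apply_left (isTopCompl_of_isCompl hW h) ⟨w, hw⟩
  have hPV : ∀ v ∈ Vᗮ, P v = 0 := fun v hv =>
    (Submodule.projectionL_apply_eq_zero_iff (isTopCompl_of_isCompl hW h)).mpr hv
  constructor
  · rw [Submodule.disjoint_def]
    intro x hxV hxW
    have hx : x ∈ W ⊔ Vᗮ := by rw [h.sup_eq_top]; trivial
    obtain ⟨w, hw, v, hv, hwv⟩ := Submodule.mem_sup.mp hx
    have h1 : ⟪x, x⟫_ℂ = 0 := by
      conv_lhs => rw [← hwv]
      rw [hwv, ← hwv, inner_add_left, inner_add_right, inner_add_right]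
      rw [← inner_add_right, ← inner_add_right, hwv,
        (Submodule.mem_orthogonal W x).mp hxW w hw,
        (Submodule.mem_orthogonal' V v).mp hv x hxV, add_zero]
    exact inner_self_eq_zero.mp h1
  · rw [codisjoint_iff, eq_top_iff]
    intro x _
    refine Submodule.mem_sup.mpr ⟨ContinuousLinearMap.adjoint P x, ?_,
      x - ContinuousLinearMap.adjoint P x, ?_, by abel⟩
    · rw [← V.orthogonal_orthogonal, Submodule.mem_orthogonal]
      intro v hv
      rw [ContinuousLinearMap.adjoint_inner_right, hPV v hv, inner_zero_left]
    · rw [Submodule.mem_orthogonal]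
      intro w hw
      rw [inner_sub_right, ContinuousLinearMap.adjoint_inner_right, hPW w hw, sub_self]

/-- `f` and `g` are `ε`-approximate oblique dual frames for the closed subspaces `W` and `V`, where
`H = W ⊕ Vᗮ`: they are frames for `W` and `V`, and `‖π_{W Vᗮ} - T_f T_g^*‖ ≤ ε` or
`‖π_{V Wᗮ} - T_g T_f^*‖ ≤ ε`. -/
def IsApproxObliqueDual (W V : Submodule ℂ H) (hW : IsClosed (W : Set H))
    (hV : IsClosed (V : Set H)) (h : IsCompl W Vᗮ) (ε : ℝ) (f g : ι → H) : Prop :=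
  ∃ (hf : IsFrame W f) (hg : IsFrame V g),
    ‖obliqueProj W V hW h
        - synthesis f (hf.isBessel hW) ∘L analysis g (hg.isBessel hV)‖ ≤ ε ∨
    ‖obliqueProj V W hV (isCompl_swap hW hV h)
        - synthesis g (hg.isBessel hV) ∘L analysis f (hf.isBessel hW)‖ ≤ ε

end Hilbert

/-- The Hilbert space `L²(ℝ)` of complex-valued functions. -/
abbrev L2R : Type := Lp ℂ 2 (volume : Measure ℝ)

/-- Translation `T_k φ (x) = φ (x - k)` on `L²(ℝ)`. -/
def translate (k : ℤ) (φ : L2R) : L2R :=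
  Lp.compMeasurePreserving (fun x : ℝ => x - (k : ℝ))
    (measurePreserving_sub_right volume (k : ℝ)) φ

/-- `Φ(γ) = ∑ₙ |φ̂(γ + n)|²`, a series that converges for almost every `γ`. -/
def periodization (φ : L2R) (γ : ℝ) : ℝ :=
  ∑' n : ℤ, ‖(𝓕 φ : L2R) (γ + n)‖ ^ 2

/-- `∑ₙ φ̂(γ + n) conj (ψ̂(γ + n))`, a series that converges for almost every `γ`. -/
def bracket (φ ψ : L2R) (γ : ℝ) : ℂ :=
  ∑' n : ℤ, (𝓕 φ : L2R) (γ + n) * starRingEnd ℂ ((𝓕 ψ : L2R) (γ + n))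

end ObliqueFrames

end

noncomputable section

namespace ObliqueFrames

/-! Everything is read on the fibres `γ + ℤ` of the Fourier side. Translation by `k` becomes
modulation by a 1-periodic character, so the numbers `⟪translate k φ, f⟫` are the Fourier
coefficients of `bracket f φ` (`inner_translate`), and Parseval turns frame sums and mixed operators
into integrals of brackets. On the span of the translates of `φ` one has `f̂ = p φ̂` with `p`
periodic, and there `T_F T_G^*` multiplies by `conj H̃ · [φ, φ₁]`. The hypothesis thus places it
within `ε / ‖π‖` of the identity on `W` (`norm_sub_synthesis_analysis_le`). As `T_G^*` kills `Vᗮ`,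
`π - T_F T_G^* = (1 - T_F T_G^*) π` has norm at most `ε` (`norm_obliqueProj_sub_le`), and `ε < 1`
then forces the lower frame bound (`isFrame_of_norm_obliqueProj_sub_le`). The upper bound is
separate, since `H̃` need not be bounded. The splitting `V ⊕ Wᗮ` gives `Φ₁ ≤ C |[φ, φ₁]|²`
(`exists_periodization_le_sq_bracket`), so `|H̃|² Φ₁` is controlled by `|H̃ [φ, φ₁]|²`, which the
hypothesis bounds. -/

/-- Lebesgue measure on the unit interval. -/
abbrev unitVol : Measure ℝ := volume.restrict (Set.Ioc (0 : ℝ) 1)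

/-! ### Periodization of integrable functions. -/

section Periodize

variable {E : Type*} [NormedAddCommGroup E]

theorem aestronglyMeasurable_tsum_of_ae_summable {α : Type*} {m : MeasurableSpace α}
    {μ : Measure α} {F : ℤ → α → E} (hF : ∀ n, AEStronglyMeasurable (F n) μ)
    (hs : ∀ᵐ a ∂μ, Summable fun n => F n a) :
    AEStronglyMeasurable (fun a => ∑' n, F n a) μ := by
  refine aestronglyMeasurable_of_tendsto_ae (Filter.atTop : Filter (Finset ℤ))
    (f := fun s a => ∑ n ∈ s, F n a) (fun s => ?_) ?_
  · exact Finset.aestronglyMeasurable_fun_sum s fun n _ => hF n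
  · filter_upwards [hs] with a ha using ha.hasSum

theorem integrable_comp_add_int {F : ℝ → E} (hF : Integrable F) (n : ℤ) :
    Integrable (fun γ => F (γ + n)) unitVol :=
  (hF.comp_add_right (n : ℝ)).restrict

theorem summable_integral_norm_comp_add_int {F : ℝ → E} (hF : Integrable F) :
    Summable fun n : ℤ => ∫ γ, ‖F (γ + n)‖ ∂unitVol := by
  have := hF.norm.hasSum_intervalIntegral_comp_add_int.summable
  simpa only [intervalIntegral.integral_of_le zero_le_one] using this

theorem lintegral_tsum_enorm_ne_top {F : ℝ → E} (hF : Integrable F) :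
    ∫⁻ γ, ∑' n : ℤ, ‖F (γ + n)‖ₑ ∂unitVol ≠ ∞ := by
  rw [lintegral_tsum fun n => (integrable_comp_add_int hF n).1.enorm]
  have : ∀ n : ℤ, ∫⁻ γ, ‖F (γ + n)‖ₑ ∂unitVol
      = ENNReal.ofReal (∫ γ, ‖F (γ + n)‖ ∂unitVol) := fun n =>
    (ofReal_integral_norm_eq_lintegral_enorm (integrable_comp_add_int hF n)).symm
  simp only [this]
  have h0 : ∀ n : ℤ, 0 ≤ ∫ γ, ‖F (γ + n)‖ ∂unitVol := fun n =>
    integral_nonneg fun _ => norm_nonneg _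
  exact (ENNReal.ofReal_tsum_of_nonneg h0 (summable_integral_norm_comp_add_int hF)) ▸
    ENNReal.ofReal_ne_top

theorem ae_summable_comp_add_int {F : ℝ → E} (hF : Integrable F) :
    ∀ᵐ γ ∂unitVol, Summable fun n : ℤ => ‖F (γ + n)‖ := by
  have hm : AEMeasurable (fun γ => ∑' n : ℤ, ‖F (γ + n)‖ₑ) unitVol :=
    AEMeasurable.tsum fun n => (integrable_comp_add_int hF n).1.enorm
  filter_upwards [ae_lt_top' hm (lintegral_tsum_enorm_ne_top hF)] with γ hγ
  have h := ENNReal.summable_toReal hγ.ne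
  simpa using h

theorem integrable_tsum_comp_add_int [CompleteSpace E] {F : ℝ → E} (hF : Integrable F) :
    Integrable (fun γ => ∑' n : ℤ, F (γ + n)) unitVol := by
  refine ⟨aestronglyMeasurable_tsum_of_ae_summable
    (fun n => (integrable_comp_add_int hF n).1) ?_, ?_⟩
  · filter_upwards [ae_summable_comp_add_int hF] with γ hγ using hγ.of_norm
  · exact (lintegral_mono fun γ => enorm_tsum_le_tsum_enorm).trans_lt
      (lintegral_tsum_enorm_ne_top hF).lt_top

theorem integral_tsum_comp_add_int [NormedSpace ℝ E] {F : ℝ → E} (hF : Integrable F) :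
    ∫ γ, ∑' n : ℤ, F (γ + n) ∂unitVol = ∫ γ, F γ := by
  have h1 := hF.hasSum_intervalIntegral_comp_add_int
  simp only [intervalIntegral.integral_of_le zero_le_one] at h1
  exact (hasSum_integral_of_summable_integral_norm (integrable_comp_add_int hF)
    (summable_integral_norm_comp_add_int hF)).unique h1

end Periodize

theorem ae_forall_add_int {p : ℝ → Prop} (h : ∀ᵐ γ : ℝ, p γ) : ∀ᵐ γ : ℝ, ∀ n : ℤ, p (γ + n) := by
  rw [ae_all_iff]
  intro n
  exact (measurePreserving_add_right volume (n : ℝ)).quasiMeasurePreserving.ae h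

/-! ### Fourier coefficients and Parseval on the unit interval. -/

section Parseval

/-- The Fourier coefficients of a function on the unit interval. -/
def unitCoeff (g : ℝ → ℂ) (k : ℤ) : ℂ :=
  ∫ γ, Complex.exp (2 * Real.pi * Complex.I * k * γ) * g γ ∂unitVol

/-- The exponent in `unitCoeff` is positive so that index `k` matches translation by `k`; the usual
coefficient has index `-k`. -/
theorem unitCoeff_eq (g : ℝ → ℂ) (k : ℤ) :
    unitCoeff g k = fourierCoeffOn (zero_lt_one : (0 : ℝ) < 1) g (-k) := by
  rw [fourierCoeffOn_eq_integral, unitCoeff, intervalIntegral.integral_of_le zero_le_one]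
  simp only [sub_zero, ne_eq, one_ne_zero, not_false_eq_true, div_self, one_smul, neg_neg,
    fourier_coe_apply, smul_eq_mul]
  congr 1
  ext γ
  simp

theorem hasSum_sq_unitCoeff {g : ℝ → ℂ} (hg : MemLp g 2 unitVol) :
    HasSum (fun k => ‖unitCoeff g k‖ ^ 2) (∫ γ, ‖g γ‖ ^ 2 ∂unitVol) := by
  have h := hasSum_sq_fourierCoeffOn zero_lt_one hg
  rw [intervalIntegral.integral_of_le zero_le_one, sub_zero, inv_one, one_smul] at h
  simp only [unitCoeff_eq]
  exact (Equiv.neg ℤ).hasSum_iff.mpr h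

/-- Polarized Parseval, via the Fourier basis of the circle; it evaluates `⟪u, T_F T_G^* f⟫` as an
integral of brackets. -/
theorem hasSum_unitCoeff_mul {g h : ℝ → ℂ} (hg : MemLp g 2 unitVol) (hh : MemLp h 2 unitVol) :
    HasSum (fun k => starRingEnd ℂ (unitCoeff g k) * unitCoeff h k)
      (∫ γ, starRingEnd ℂ (g γ) * h γ ∂unitVol) := by
  have hg' : MemLp g 2 (volume.restrict (Set.Ioc (0 : ℝ) (0 + 1))) := by simpa using hg
  have hh' : MemLp h 2 (volume.restrict (Set.Ioc (0 : ℝ) (0 + 1))) := by simpa using hh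
  have Hg := hg'.memLp_liftIoc.haarAddCircle
  have Hh := hh'.memLp_liftIoc.haarAddCircle
  set A : Lp ℂ 2 (AddCircle.haarAddCircle (T := 1)) := Hg.toLp with hA
  set B : Lp ℂ 2 (AddCircle.haarAddCircle (T := 1)) := Hh.toLp with hB
  have key := (fourierBasis (T := 1)).hasSum_inner_mul_inner A B
  have coef : ∀ {u : ℝ → ℂ}
      (hu : MemLp (AddCircle.liftIoc 1 0 u) 2 (AddCircle.haarAddCircle (T := 1))) (k : ℤ),
      ⟪fourierBasis (T := 1) k, hu.toLp⟫_ℂ = unitCoeff u (-k) := by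
    intro u hu k
    rw [← HilbertBasis.repr_apply_apply, fourierBasis_repr, fourierCoeff_congr_ae hu.coeFn_toLp,
      fourierCoeff_liftIoc_eq, unitCoeff_eq, neg_neg]
    congr 1
    simp
  have hin : ⟪A, B⟫_ℂ = ∫ γ, starRingEnd ℂ (g γ) * h γ ∂unitVol := by
    rw [L2.inner_def]
    have : (∫ a, ⟪A a, B a⟫_ℂ ∂AddCircle.haarAddCircle (T := 1))
        = ∫ a, AddCircle.liftIoc 1 0 (fun γ => starRingEnd ℂ (g γ) * h γ) a
          ∂AddCircle.haarAddCircle (T := 1) := by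
      apply integral_congr_ae
      filter_upwards [Hg.coeFn_toLp, Hh.coeFn_toLp] with x h1 h2
      rw [h1, h2, RCLike.inner_apply']
      rfl
    rw [this, AddCircle.integral_haarAddCircle, AddCircle.integral_liftIoc_eq_intervalIntegral,
      zero_add, intervalIntegral.integral_of_le zero_le_one]
    simp
  rw [hin] at key
  refine (Equiv.neg ℤ).hasSum_iff.mp ?_
  change HasSum (fun k => starRingEnd ℂ (unitCoeff g (-k)) * unitCoeff h (-k)) _
  have hk : ∀ k : ℤ, starRingEnd ℂ (unitCoeff g (-k)) * unitCoeff h (-k)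
      = ⟪A, fourierBasis k⟫_ℂ * ⟪fourierBasis k, B⟫_ℂ := fun k => by
    rw [← inner_conj_symm A, coef Hg, coef Hh]
  simpa only [← hk] using key

theorem ae_eq_zero_of_unitCoeff_eq_zero {g : ℝ → ℂ} (hg : MemLp g 2 unitVol)
    (h : ∀ k, unitCoeff g k = 0) : g =ᵐ[unitVol] 0 := by
  have h1 := hasSum_sq_unitCoeff hg
  simp only [h, norm_zero, ne_eq, OfNat.ofNat_ne_zero, not_false_eq_true, zero_pow] at h1
  have h2 := (hasSum_zero.unique h1).symm
  rw [integral_eq_zero_iff_of_nonneg (fun _ => by positivity) hg.norm.integrable_sq] at h2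
  filter_upwards [h2] with γ hγ
  simpa using hγ

end Parseval

/-! ### Translation and modulation. -/

section FourierTranslate

/-- Pointwise multiplication of `L²` functions by a bounded measurable function. -/
theorem exists_coeFn_eq_mul {m : ℝ → ℂ} (hm : Measurable m) {C : ℝ} (hC : ∀ γ, ‖m γ‖ ≤ C)
    (f : L2R) : ∃ g : L2R, g =ᵐ[volume] fun γ => m γ * f γ := by
  have h : MemLp (fun γ => m γ * f γ) 2 (volume : Measure ℝ) :=
    (Lp.memLp f).mul (memLp_top_of_bound hm.aestronglyMeasurable C (ae_of_all _ hC))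
  exact ⟨h.toLp, h.coeFn_toLp⟩

theorem exists_fourier_eq_mul {m : ℝ → ℂ} (hm : Measurable m) {C : ℝ} (hC : ∀ γ, ‖m γ‖ ≤ C)
    (f : L2R) : ∃ g : L2R, (𝓕 g : L2R) =ᵐ[volume] fun γ => m γ * (𝓕 f : L2R) γ := by
  obtain ⟨g, hg⟩ := exists_coeFn_eq_mul hm hC (𝓕 f)
  refine ⟨𝓕⁻ g, ?_⟩
  rwa [FourierTransform.fourier_fourierInv_eq]

/-- The character `γ ↦ exp (2πikγ)`. -/
def expChar (k : ℤ) (γ : ℝ) : ℂ := Complex.exp (2 * Real.pi * Complex.I * k * γ)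

theorem norm_expChar (k : ℤ) (γ : ℝ) : ‖expChar k γ‖ = 1 := by
  rw [expChar, show (2 * Real.pi * Complex.I * k * γ : ℂ)
    = ((2 * Real.pi * k * γ : ℝ) : ℂ) * Complex.I by push_cast; ring]
  exact Complex.norm_exp_ofReal_mul_I _

theorem continuous_expChar (k : ℤ) : Continuous (expChar k) := by
  unfold expChar
  fun_prop

theorem periodic_expChar (k : ℤ) : Function.Periodic (expChar k) 1 := by
  intro γ
  rw [expChar, expChar, Complex.exp_eq_exp_iff_exists_int]
  exact ⟨k, by push_cast; ring⟩

theorem conj_expChar (k : ℤ) (γ : ℝ) : starRingEnd ℂ (expChar k γ) = expChar (-k) γ := by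
  rw [expChar, expChar, ← Complex.exp_conj]
  congr 1
  simp [Complex.conj_ofNat]

theorem fourier_compSubConst (f : SchwartzMap ℝ ℂ) (k : ℤ) (γ : ℝ) :
    𝓕 (f.compSubConstCLM ℂ (k : ℝ)) γ = expChar (-k) γ * 𝓕 f γ := by
  rw [SchwartzMap.fourier_coe, SchwartzMap.fourier_coe, Real.fourier_real_eq_integral_exp_smul,
    Real.fourier_real_eq_integral_exp_smul, ← integral_const_mul]
  simp only [SchwartzMap.compSubConstCLM_apply]
  rw [← integral_add_right_eq_self _ (k : ℝ)]
  congr 1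
  ext x
  rw [add_sub_cancel_right, smul_eq_mul, smul_eq_mul, ← mul_assoc, expChar, ← Complex.exp_add]
  congr 2
  push_cast
  ring

theorem coeFn_translate (k : ℤ) (φ : L2R) :
    translate k φ =ᵐ[volume] fun x => φ (x - k) :=
  Lp.coeFn_compMeasurePreserving _ _

/-- Translation becomes modulation under the Fourier transform. -/
theorem fourier_translate (k : ℤ) (φ : L2R) :
    (𝓕 (translate k φ) : L2R) =ᵐ[volume] fun γ => expChar (-k) γ * (𝓕 φ : L2R) γ := by
  -- Modulation is realized as a bounded operator `M`, so that the identity is a closed condition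
  -- and need only be checked on Schwartz functions.
  have hmem : MemLp (expChar (-k)) ∞ (volume : Measure ℝ) :=
    memLp_top_of_bound (continuous_expChar _).aestronglyMeasurable 1
      (ae_of_all _ fun γ => (norm_expChar _ γ).le)
  set e : Lp ℂ ∞ (volume : Measure ℝ) := hmem.toLp with he
  let M : L2R →L[ℂ] L2R := (ContinuousLinearMap.mul ℂ ℂ).holderL volume ∞ 2 2 e
  have hM : ∀ f : L2R, M f =ᵐ[volume] fun γ => expChar (-k) γ * f γ := by
    intro f
    filter_upwards [(ContinuousLinearMap.mul ℂ ℂ).coeFn_holder (r := 2) e f,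
      hmem.coeFn_toLp] with γ h1 h2
    simp only [M, ContinuousLinearMap.holderL_apply_apply]
    rw [h1, he, h2]
    rfl
  suffices h : 𝓕 (translate k φ) = M (𝓕 φ) by rw [h]; exact hM _
  have hd : DenseRange (SchwartzMap.toLpCLM ℂ ℂ 2 (volume : Measure ℝ)) :=
    SchwartzMap.denseRange_toLpCLM ENNReal.ofNat_ne_top
  refine hd.induction_on (p := fun φ : L2R => 𝓕 (translate k φ) = M (𝓕 φ)) φ ?_ ?_
  · refine isClosed_eq ?_ ?_
    · have : Continuous (translate k) :=
        (Lp.isometry_compMeasurePreserving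
          (measurePreserving_sub_right volume (k : ℝ))).continuous
      exact (Lp.fourierTransformₗᵢ ℝ ℂ).continuous.comp this
    · exact M.continuous.comp (Lp.fourierTransformₗᵢ ℝ ℂ).continuous
  · intro f
    have h1 : translate k (f.toLp 2) = (f.compSubConstCLM ℂ (k : ℝ)).toLp 2 := by
      apply Lp.ext
      filter_upwards [coeFn_translate k (f.toLp 2), (f.compSubConstCLM ℂ (k : ℝ)).coeFn_toLp 2,
        (measurePreserving_sub_right volume (k : ℝ)).quasiMeasurePreserving.ae
          (f.coeFn_toLp 2 volume)] with x h1 h2 h3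
      rw [h1, h2, h3]
      rfl
    change 𝓕 (translate k (f.toLp 2)) = M (𝓕 (f.toLp 2))
    rw [h1, SchwartzMap.toLp_fourier_eq, SchwartzMap.toLp_fourier_eq]
    apply Lp.ext
    filter_upwards [hM ((𝓕 f).toLp 2), (𝓕 f).coeFn_toLp 2,
      (𝓕 (f.compSubConstCLM ℂ (k : ℝ))).coeFn_toLp 2] with γ h1 h2 h3
    rw [h1, h2, h3, fourier_compSubConst]

end FourierTranslate

/-! ### The bracket product. -/

section Bracket

theorem integrable_fourier_mul_conj (f g : L2R) :
    Integrable fun γ => (𝓕 f : L2R) γ * starRingEnd ℂ ((𝓕 g : L2R) γ) := by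
  simpa [RCLike.inner_apply] using L2.integrable_inner (𝕜 := ℂ) (𝓕 g : L2R) (𝓕 f)

theorem integrable_fourier_sq (f : L2R) : Integrable fun γ => ‖(𝓕 f : L2R) γ‖ ^ 2 :=
  (Lp.memLp (𝓕 f : L2R)).norm.integrable_sq

theorem integrable_bracket (f g : L2R) : Integrable (bracket f g) unitVol :=
  integrable_tsum_comp_add_int (integrable_fourier_mul_conj f g)

theorem integrable_periodization (f : L2R) : Integrable (periodization f) unitVol :=
  integrable_tsum_comp_add_int (integrable_fourier_sq f)

theorem periodization_nonneg (f : L2R) (γ : ℝ) : 0 ≤ periodization f γ :=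
  tsum_nonneg fun _ => by positivity

theorem integral_bracket (f g : L2R) : ∫ γ, bracket f g γ ∂unitVol = ⟪g, f⟫_ℂ := by
  rw [← Lp.inner_fourier_eq, L2.inner_def]
  simp only [RCLike.inner_apply]
  exact integral_tsum_comp_add_int (integrable_fourier_mul_conj f g)

theorem integral_periodization (f : L2R) : ∫ γ, periodization f γ ∂unitVol = ‖f‖ ^ 2 := by
  rw [← Lp.norm_fourier_eq]
  refine (integral_tsum_comp_add_int (integrable_fourier_sq f)).trans ?_
  have h := congrArg RCLike.re (L2.inner_def (𝕜 := ℂ) (𝓕 f : L2R) (𝓕 f))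
  rw [← integral_re (L2.integrable_inner _ _)] at h
  simp only [← norm_sq_eq_re_inner] at h
  exact h.symm

/-- Cauchy–Schwarz in `ℓ²` of the fibre `γ + ℤ`. -/
theorem norm_bracket_le (f g : L2R) :
    ∀ᵐ γ ∂unitVol, ‖bracket f g γ‖ ≤ √(periodization f γ) * √(periodization g γ) := by
  filter_upwards [ae_summable_comp_add_int (integrable_fourier_mul_conj f g),
    ae_summable_comp_add_int (integrable_fourier_sq f),
    ae_summable_comp_add_int (integrable_fourier_sq g)] with γ h1 h2 h3
  refine (norm_tsum_le_tsum_norm h1).trans ?_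
  simp only [norm_pow, norm_norm] at h2 h3
  have := Real.inner_le_Lp_mul_Lq_tsum_of_nonneg (p := 2) (q := 2) Real.HolderConjugate.two_two
    (f := fun n : ℤ => ‖(𝓕 f : L2R) (γ + n)‖) (g := fun n : ℤ => ‖(𝓕 g : L2R) (γ + n)‖)
    (fun _ => norm_nonneg _) (fun _ => norm_nonneg _) (by simpa using h2) (by simpa using h3)
  simpa [periodization, Real.sqrt_eq_rpow] using this

theorem bracket_conj (f g : L2R) (γ : ℝ) :
    starRingEnd ℂ (bracket f g γ) = bracket g f γ := by
  rw [bracket, bracket, Complex.conj_tsum]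
  simp [mul_comm]

theorem periodic_add_int {m : ℝ → ℂ} (hm : Function.Periodic m 1) (γ : ℝ) (n : ℤ) :
    m (γ + n) = m γ := by
  simpa using hm.int_mul n γ

/-- A periodic multiplier is constant on each fibre, hence leaves the sum. -/
theorem bracket_of_fourier_eq_mul {f g : L2R} {m : ℝ → ℂ} (hm : Function.Periodic m 1)
    (h : (𝓕 f : L2R) =ᵐ[volume] fun γ => m γ * (𝓕 g : L2R) γ) (u : L2R) :
    ∀ᵐ γ ∂unitVol, bracket f u γ = m γ * bracket g u γ := by
  filter_upwards [ae_restrict_of_ae (ae_forall_add_int h)] with γ hγ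
  rw [bracket, bracket, ← tsum_mul_left]
  congr 1
  ext n
  rw [hγ n, periodic_add_int hm, mul_assoc]

theorem bracket_of_fourier_eq_mul_right {f g : L2R} {m : ℝ → ℂ} (hm : Function.Periodic m 1)
    (h : (𝓕 f : L2R) =ᵐ[volume] fun γ => m γ * (𝓕 g : L2R) γ) (u : L2R) :
    ∀ᵐ γ ∂unitVol, bracket u f γ = starRingEnd ℂ (m γ) * bracket u g γ := by
  filter_upwards [bracket_of_fourier_eq_mul hm h u] with γ hγ
  rw [← bracket_conj f u, hγ, map_mul, bracket_conj]

theorem periodization_of_fourier_eq_mul {f g : L2R} {m : ℝ → ℂ} (hm : Function.Periodic m 1)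
    (h : (𝓕 f : L2R) =ᵐ[volume] fun γ => m γ * (𝓕 g : L2R) γ) :
    ∀ᵐ γ ∂unitVol, periodization f γ = ‖m γ‖ ^ 2 * periodization g γ := by
  filter_upwards [ae_restrict_of_ae (ae_forall_add_int h)] with γ hγ
  rw [periodization, periodization, ← tsum_mul_left]
  congr 1
  ext n
  rw [hγ n, periodic_add_int hm, norm_mul, mul_pow]

/-- A bracket is a priori only integrable; a bound on one periodization makes it square integrable,
as Parseval requires. -/
theorem memLp_bracket {φ : L2R} {B : ℝ} (hB : ∀ᵐ γ ∂unitVol, periodization φ γ ≤ B) (f : L2R) :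
    MemLp (bracket f φ) 2 unitVol := by
  rw [memLp_two_iff_integrable_sq_norm (integrable_bracket f φ).1]
  refine ((integrable_periodization f).mul_const B).mono'
    ((integrable_bracket f φ).1.norm.pow 2) ?_
  filter_upwards [hB, norm_bracket_le f φ] with γ h1 h2
  rw [norm_pow, norm_norm]
  calc ‖bracket f φ γ‖ ^ 2 ≤ (√(periodization f γ) * √(periodization φ γ)) ^ 2 := by gcongr
    _ = periodization f γ * periodization φ γ := by
      rw [mul_pow, Real.sq_sqrt (periodization_nonneg _ _),
        Real.sq_sqrt (periodization_nonneg _ _)]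
    _ ≤ _ := mul_le_mul_of_nonneg_left h1 (periodization_nonneg _ _)

theorem inner_translate (k : ℤ) (φ f : L2R) :
    ⟪translate k φ, f⟫_ℂ = unitCoeff (bracket f φ) k := by
  rw [← integral_bracket, unitCoeff]
  apply integral_congr_ae
  filter_upwards [bracket_of_fourier_eq_mul_right (periodic_expChar (-k))
    (fourier_translate k φ) f] with γ hγ
  rw [hγ, conj_expChar, neg_neg]
  rfl

theorem hasSum_sq_inner_translate {φ f : L2R} (h : MemLp (bracket f φ) 2 unitVol) :
    HasSum (fun k => ‖⟪translate k φ, f⟫_ℂ‖ ^ 2) (∫ γ, ‖bracket f φ γ‖ ^ 2 ∂unitVol) := by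
  simpa only [inner_translate] using hasSum_sq_unitCoeff h

end Bracket

/-! ### Frames and oblique projections in a Hilbert space. -/

section Hilbert

variable {H : Type*} [NormedAddCommGroup H] [InnerProductSpace ℂ H]
variable {ι : Type*}

theorem IsFrame.span_le {W : Submodule ℂ H} {f : ι → H} (hf : IsFrame W f) :
    Submodule.span ℂ (Set.range f) ≤ W :=
  Submodule.span_le.mpr (by rintro _ ⟨k, rfl⟩; exact hf.mem k)

variable [CompleteSpace H]

theorem norm_analysis_sq (f : ι → H) (hf : IsBessel f) (x : H) :
    ‖analysis f hf x‖ ^ 2 = ∑' k, ‖⟪f k, x⟫_ℂ‖ ^ 2 := by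
  have := lp.norm_rpow_eq_tsum (p := 2) (by norm_num) (analysis f hf x)
  simpa only [analysis_apply, ENNReal.toReal_ofNat, Real.rpow_ofNat] using this

/-- The members of a frame for a closed subspace span a dense subspace of it. -/
theorem IsFrame.le_topologicalClosure_span {W : Submodule ℂ H} {f : ι → H}
    (hW : IsClosed (W : Set H)) (hf : IsFrame W f) :
    W ≤ (Submodule.span ℂ (Set.range f)).topologicalClosure := by
  intro x hx
  set S := (Submodule.span ℂ (Set.range f)).topologicalClosure with hS
  have : CompleteSpace S := (Submodule.isClosed_topologicalClosure _).completeSpace_coe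
  have hSW : S ≤ W := Submodule.topologicalClosure_minimal _ hf.span_le hW
  obtain ⟨α, β, hα, -, h⟩ := hf.bounds
  set y := x - S.starProjection x with hy
  have hyW : y ∈ W := W.sub_mem hx (hSW (S.starProjection_apply_mem x))
  have hz : ∀ k, ⟪f k, y⟫_ℂ = 0 := fun k =>
    (Submodule.mem_orthogonal S y).mp (S.sub_starProjection_mem_orthogonal x) (f k)
      (Submodule.le_topologicalClosure _ (Submodule.subset_span ⟨k, rfl⟩))
  have h1 := (h y hyW).2.1
  simp only [hz, norm_zero, ne_eq, OfNat.ofNat_ne_zero, not_false_eq_true, zero_pow,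
    tsum_zero] at h1
  have h2 : y = 0 := by
    rw [← norm_eq_zero, ← sq_eq_zero_iff]
    exact le_antisymm (nonpos_of_mul_nonpos_right h1 hα) (sq_nonneg _)
  rw [sub_eq_zero.mp h2]
  exact S.starProjection_apply_mem x

theorem obliqueProj_mem {W V : Submodule ℂ H} (hW : IsClosed (W : Set H)) (h : IsCompl W Vᗮ)
    (x : H) : obliqueProj W V hW h x ∈ W :=
  Submodule.projectionL_apply_mem (isTopCompl_of_isCompl hW h) x

theorem obliqueProj_of_mem {W V : Submodule ℂ H} (hW : IsClosed (W : Set H))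
    (h : IsCompl W Vᗮ) {x : H} (hx : x ∈ W) : obliqueProj W V hW h x = x :=
  Submodule.projectionL_apply_left (isTopCompl_of_isCompl hW h) ⟨x, hx⟩

theorem obliqueProj_eq_zero {W V : Submodule ℂ H} (hW : IsClosed (W : Set H))
    (h : IsCompl W Vᗮ) {x : H} (hx : x ∈ Vᗮ) : obliqueProj W V hW h x = 0 :=
  (Submodule.projectionL_apply_eq_zero_iff (isTopCompl_of_isCompl hW h)).mpr hx

theorem sub_obliqueProj_mem {W V : Submodule ℂ H} (hW : IsClosed (W : Set H))
    (h : IsCompl W Vᗮ) (x : H) : x - obliqueProj W V hW h x ∈ Vᗮ := by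
  refine (Submodule.projectionL_apply_eq_zero_iff (isTopCompl_of_isCompl hW h)).mp ?_
  change obliqueProj W V hW h (x - obliqueProj W V hW h x) = 0
  rw [map_sub, obliqueProj_of_mem hW h (obliqueProj_mem hW h x), sub_self]

/-- If `H = V ⊕ Wᗮ`, the analysis operator of a frame for `W` is bounded below on `V`. -/
theorem IsFrame.exists_sq_norm_le_of_isCompl {W V : Submodule ℂ H} {f : ι → H}
    (hW : IsClosed (W : Set H)) (hV : IsClosed (V : Set H)) (hf : IsFrame W f)
    (h : IsCompl V Wᗮ) :
    ∃ C : ℝ, 0 ≤ C ∧ ∀ v ∈ V, ‖v‖ ^ 2 ≤ C * ∑' k, ‖⟪f k, v⟫_ℂ‖ ^ 2 := by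
  have : CompleteSpace W := hW.completeSpace_coe
  obtain ⟨α, β, hα, -, hb⟩ := hf.bounds
  set P := obliqueProj V W hV h with hP
  -- The orthogonal projection `w` of `v` onto `W` has the same frame coefficients, and `P w = v`
  -- because `P` kills `Wᗮ`; hence the factor `‖P‖ ^ 2`.
  refine ⟨‖P‖ ^ 2 / α, by positivity, fun v hv => ?_⟩
  set w := W.starProjection v with hw
  have h1 : P w = v := by
    have h2 : P (v - w) = 0 := obliqueProj_eq_zero hV h (W.sub_starProjection_mem_orthogonal v)
    rw [map_sub, hP, obliqueProj_of_mem hV h hv, sub_eq_zero] at h2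
    exact h2.symm
  have hin : ∀ k, ⟪f k, v⟫_ℂ = ⟪f k, w⟫_ℂ := fun k => by
    rw [hw, ← W.inner_starProjection_left_eq_right,
      Submodule.starProjection_eq_self_iff.mpr (hf.mem k)]
  simp only [hin]
  have h3 := (hb w (W.starProjection_apply_mem v)).2.1
  calc ‖v‖ ^ 2 = ‖P w‖ ^ 2 := by rw [h1]
    _ ≤ (‖P‖ * ‖w‖) ^ 2 := by gcongr; exact P.le_opNorm w
    _ = ‖P‖ ^ 2 / α * (α * ‖w‖ ^ 2) := by field_simp
    _ ≤ _ := by gcongr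

theorem inner_synthesis_analysis (f g : ι → H) (hf : IsBessel f) (hg : IsBessel g) (x y : H) :
    ⟪x, synthesis f hf (analysis g hg y)⟫_ℂ
      = ∑' k, starRingEnd ℂ ⟪f k, x⟫_ℂ * ⟪g k, y⟫_ℂ := by
  rw [synthesis, ContinuousLinearMap.adjoint_inner_right, lp.inner_eq_tsum]
  simp only [analysis_apply, RCLike.inner_apply']

/-- If `T_f T_g^*` is within `δ / ‖π‖` of the identity on `W`, it is within `δ` of the oblique
projection `π` onto `W` along `Vᗮ`. -/
theorem norm_obliqueProj_sub_le {W V : Submodule ℂ H} (hW : IsClosed (W : Set H))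
    (h : IsCompl W Vᗮ) {f g : ι → H} (hf : IsBessel f) (hg : IsBessel g)
    (hgV : ∀ k, g k ∈ V) {ε : ℝ} (hε : 0 ≤ ε)
    (hest : ∀ w ∈ W, ‖w - synthesis f hf (analysis g hg w)‖
      ≤ ε / ‖obliqueProj W V hW h‖ * ‖w‖) :
    ‖obliqueProj W V hW h - synthesis f hf ∘L analysis g hg‖ ≤ ε := by
  set P := obliqueProj W V hW h with hP
  refine ContinuousLinearMap.opNorm_le_bound _ hε fun x => ?_
  have hx : analysis g hg x = analysis g hg (P x) := by
    ext k
    rw [analysis_apply, analysis_apply, ← sub_eq_zero, ← inner_sub_right]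
    exact (Submodule.mem_orthogonal V _).mp (sub_obliqueProj_mem hW h x) _ (hgV k)
  have h1 := hest (P x) (obliqueProj_mem hW h x)
  rw [sub_apply, ContinuousLinearMap.comp_apply, hx]
  refine h1.trans ?_
  calc ε / ‖P‖ * ‖P x‖ ≤ ε / ‖P‖ * (‖P‖ * ‖x‖) := by gcongr; exact P.le_opNorm x
    _ = ε / ‖P‖ * ‖P‖ * ‖x‖ := by ring
    _ ≤ ε * ‖x‖ := by
      gcongr
      rcases eq_or_ne ‖P‖ 0 with h0 | h0
      · rw [h0, mul_zero]; exact hε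
      · rw [div_mul_cancel₀ _ h0]

/-- A Bessel sequence in `V` that is an approximate oblique dual of a Bessel sequence, with error
below one, is a frame for `V`. -/
theorem isFrame_of_norm_obliqueProj_sub_le {W V : Submodule ℂ H} (hW : IsClosed (W : Set H))
    (h : IsCompl W Vᗮ) {f g : ι → H} (hf : IsBessel f) (hg : IsBessel g)
    (hgV : ∀ k, g k ∈ V) {ε : ℝ} (hε : ε < 1)
    (hest : ‖obliqueProj W V hW h - synthesis f hf ∘L analysis g hg‖ ≤ ε) :
    IsFrame V g := by
  refine ⟨hgV, ?_⟩
  obtain ⟨β, hβ⟩ := id hg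
  -- The added `1` only makes the divisor positive.
  set A := ‖analysis f hf‖ + 1 with hA
  have hA0 : 0 < A := by positivity
  have hε1 : 0 < 1 - ε := by linarith
  have hc : 0 < ((1 - ε) / A) ^ 2 := by positivity
  refine ⟨((1 - ε) / A) ^ 2, max β (((1 - ε) / A) ^ 2), hc, le_max_right _ _, fun x hx =>
    ⟨(hβ x).1, ?_, (hβ x).2.trans (by gcongr; exact le_max_left _ _)⟩⟩
  rw [← norm_analysis_sq g hg x, ← mul_pow]
  refine pow_le_pow_left₀ (by positivity) ?_ 2
  rcases eq_or_ne x 0 with rfl | hx0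
  · simp
  have hn : 0 < ‖x‖ := norm_pos_iff.mpr hx0
  set P := obliqueProj W V hW h with hP
  set D := P - synthesis f hf ∘L analysis g hg with hD
  -- For `x ∈ V` the difference `x - P x ∈ Vᗮ` is invisible to `x`, so `‖x‖²` splits into an error
  -- of size `ε ‖x‖²` and a pairing of coefficient sequences.
  have h1 : ⟪x, P x⟫_ℂ = ⟪x, x⟫_ℂ := by
    have := (Submodule.mem_orthogonal V _).mp (sub_obliqueProj_mem hW h x) x hx
    rw [inner_sub_right, sub_eq_zero] at this
    exact this.symm
  have h2 : ⟪x, x⟫_ℂ = ⟪x, D x⟫_ℂ + ⟪analysis f hf x, analysis g hg x⟫_ℂ := by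
    rw [← h1, hD, sub_apply, inner_sub_right, ContinuousLinearMap.comp_apply,
      synthesis, ContinuousLinearMap.adjoint_inner_right]
    ring
  have h3 : ‖x‖ * ‖x‖ ≤ ‖x‖ * (ε * ‖x‖) + (A * ‖x‖) * ‖analysis g hg x‖ := by
    calc ‖x‖ * ‖x‖ = ‖⟪x, x⟫_ℂ‖ := by rw [inner_self_eq_norm_sq_to_K]; simp [sq]
      _ ≤ ‖⟪x, D x⟫_ℂ‖ + ‖⟪analysis f hf x, analysis g hg x⟫_ℂ‖ := by
        rw [h2]; exact norm_add_le _ _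
      _ ≤ ‖x‖ * ‖D x‖ + ‖analysis f hf x‖ * ‖analysis g hg x‖ :=
        add_le_add (norm_inner_le_norm _ _) (norm_inner_le_norm _ _)
      _ ≤ _ := by
        gcongr
        · exact D.le_of_opNorm_le hest x
        · exact (analysis f hf).le_of_opNorm_le (by linarith) x
  have h4 : ‖x‖ * ((1 - ε) * ‖x‖) ≤ ‖x‖ * (A * ‖analysis g hg x‖) := by linarith
  have h5 := le_of_mul_le_mul_left h4 hn
  rw [div_mul_eq_mul_div, div_le_iff₀ hA0]
  linarith

end Hilbert

/-! ### Systems of integer translates. -/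

section Translates

/-- The `L²` norm of the bracket is controlled by a bound for one of the periodizations. -/
theorem integral_sq_bracket_le {φ : L2R} {B : ℝ} (hB : ∀ᵐ γ ∂unitVol, periodization φ γ ≤ B)
    (f : L2R) : ∫ γ, ‖bracket f φ γ‖ ^ 2 ∂unitVol ≤ B * ‖f‖ ^ 2 := by
  rw [← integral_periodization, ← integral_const_mul]
  refine integral_mono_ae (memLp_bracket hB f).norm.integrable_sq
    ((integrable_periodization f).const_mul B) ?_
  filter_upwards [hB, norm_bracket_le f φ] with γ h1 h2
  calc ‖bracket f φ γ‖ ^ 2 ≤ (√(periodization f γ) * √(periodization φ γ)) ^ 2 := by gcongr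
    _ = periodization φ γ * periodization f γ := by
      rw [mul_pow, Real.sq_sqrt (periodization_nonneg _ _),
        Real.sq_sqrt (periodization_nonneg _ _), mul_comm]
    _ ≤ B * periodization f γ := mul_le_mul_of_nonneg_right h1 (periodization_nonneg _ _)

theorem isBessel_of_periodization_le {φ : L2R} {B : ℝ}
    (hB : ∀ᵐ γ ∂unitVol, periodization φ γ ≤ B) : IsBessel fun k : ℤ => translate k φ := by
  refine ⟨B, fun f => ?_⟩
  have h := hasSum_sq_inner_translate (memLp_bracket hB f)
  exact ⟨h.summable, h.tsum_eq.trans_le (integral_sq_bracket_le hB f)⟩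

theorem ae_fract_eq : ∀ᵐ γ ∂unitVol, Int.fract γ = γ := by
  have h1 : ∀ᵐ γ ∂unitVol, γ ≠ (1 : ℝ) :=
    ae_restrict_of_ae (by simp [ae_iff])
  filter_upwards [h1, ae_restrict_mem measurableSet_Ioc] with γ h2 h3
  exact Int.fract_eq_self.mpr ⟨h3.1.le, lt_of_le_of_ne h3.2 h2⟩

/-- Cutting the Fourier transform off to the `ℤ`-periodization of a measurable set. -/
theorem exists_fourier_eq_indicator_mul {s : Set ℝ} (hs : MeasurableSet s) (f : L2R) :
    ∃ (g : L2R) (m : ℝ → ℂ), Function.Periodic m 1 ∧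
      ((𝓕 g : L2R) =ᵐ[volume] fun γ => m γ * (𝓕 f : L2R) γ) ∧
      ∀ᵐ γ ∂unitVol, m γ = s.indicator 1 γ := by
  have hm : Measurable fun γ : ℝ => s.indicator (1 : ℝ → ℂ) (Int.fract γ) :=
    (measurable_one.indicator hs).comp measurable_fract
  obtain ⟨g, hg⟩ := exists_fourier_eq_mul hm (C := 1) (fun γ => by
    by_cases h : Int.fract γ ∈ s <;> simp [h]) f
  refine ⟨g, _, fun γ => by simp, hg, ?_⟩
  filter_upwards [ae_fract_eq] with γ hγ
  rw [hγ]

theorem bracket_self (f : L2R) (γ : ℝ) : bracket f f γ = (periodization f γ : ℂ) := by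
  rw [bracket, periodization, Complex.ofReal_tsum]
  congr 1
  ext n
  rw [Complex.mul_conj, Complex.normSq_eq_norm_sq]

theorem measurable_periodization (f : L2R) : Measurable (periodization f) := by
  unfold periodization
  exact Measurable.tsum fun n =>
    (((Lp.stronglyMeasurable (𝓕 f : L2R)).measurable.comp (measurable_add_const _)).norm).pow_const 2

/-- Cut `φ̂` off to `s = {β < Φ ≤ N}`. The Bessel inequality for the result reads `∫_s Φ² ≤ β ∫_s
Φ`, although `Φ² > β Φ` on `s`; so `s` is null. The cap `N` secures square integrability before `Φ`
is known to be bounded. -/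
theorem exists_periodization_le_of_isBessel {φ : L2R}
    (h : IsBessel fun k : ℤ => translate k φ) : ∃ B : ℝ, ∀ᵐ γ ∂unitVol, periodization φ γ ≤ B := by
  obtain ⟨β₀, hβ₀⟩ := h
  set β := max β₀ 0 with hβ
  have hβ1 : 0 ≤ β := le_max_right _ _
  refine ⟨β, ?_⟩
  suffices hN : ∀ N : ℕ, ∀ᵐ γ ∂unitVol, periodization φ γ ≤ N → periodization φ γ ≤ β by
    filter_upwards [ae_all_iff.mpr hN] with γ hγ
    obtain ⟨N, hN'⟩ := exists_nat_ge (periodization φ γ)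
    exact hγ N hN'
  intro N
  set s : Set ℝ := {γ | β < periodization φ γ ∧ periodization φ γ ≤ N} with hs
  have hsm : MeasurableSet s :=
    (measurableSet_lt measurable_const (measurable_periodization φ)).inter
      (measurableSet_le (measurable_periodization φ) measurable_const)
  obtain ⟨g, m, hmp, hg, hms⟩ := exists_fourier_eq_indicator_mul hsm φ
  have hΦg : ∀ᵐ γ ∂unitVol, periodization g γ = s.indicator (periodization φ) γ := by
    filter_upwards [periodization_of_fourier_eq_mul hmp hg, hms] with γ h1 h2
    rw [h1, h2]
    by_cases hγ : γ ∈ s <;> simp [hγ]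
  have hbr : ∀ᵐ γ ∂unitVol, ‖bracket g φ γ‖ = s.indicator (periodization φ) γ := by
    filter_upwards [bracket_of_fourier_eq_mul hmp hg φ, hms] with γ h1 h2
    rw [h1, h2, bracket_self]
    by_cases hγ : γ ∈ s <;> simp [hγ, abs_of_nonneg (periodization_nonneg φ γ)]
  have hgN : ∀ᵐ γ ∂unitVol, periodization g γ ≤ N := by
    filter_upwards [hΦg] with γ h1
    rw [h1]
    by_cases hγ : γ ∈ s
    · simpa [hγ] using hγ.2
    · simp [hγ]
  have hmem : MemLp (bracket g φ) 2 unitVol := by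
    have := (memLp_bracket hgN φ).star
    refine this.ae_eq (ae_of_all _ fun γ => ?_)
    exact bracket_conj φ g γ
  have hle : ∫ γ, ‖bracket g φ γ‖ ^ 2 ∂unitVol ≤ ∫ γ, β * periodization g γ ∂unitVol := by
    rw [integral_const_mul, integral_periodization, ← (hasSum_sq_inner_translate hmem).tsum_eq]
    exact (hβ₀ g).2.trans (by gcongr; exact le_max_left _ _)
  have hint := hmem.norm.integrable_sq.sub ((integrable_periodization g).const_mul β)
  have hnn : 0 ≤ᵐ[unitVol] fun γ => ‖bracket g φ γ‖ ^ 2 - β * periodization g γ := by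
    filter_upwards [hΦg, hbr] with γ h1 h2
    rw [h1, h2]
    by_cases hγ : γ ∈ s
    · simp only [hγ, Set.indicator_of_mem, Pi.zero_apply]
      nlinarith [hγ.1, hβ1]
    · simp [hγ]
  have hzero : (fun γ => ‖bracket g φ γ‖ ^ 2 - β * periodization g γ) =ᵐ[unitVol] 0 := by
    rw [← integral_eq_zero_iff_of_nonneg_ae hnn hint]
    refine le_antisymm ?_ (integral_nonneg_of_ae hnn)
    rw [integral_sub hmem.norm.integrable_sq ((integrable_periodization g).const_mul β)]
    linarith
  filter_upwards [hzero, hΦg, hbr] with γ h0 h1 h2 h3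
  by_contra! h4
  have hγ : γ ∈ s := ⟨h4, h3⟩
  rw [h1, h2] at h0
  simp only [hγ, Set.indicator_of_mem, Pi.zero_apply] at h0
  nlinarith [mul_pos (hβ1.trans_lt h4) (sub_pos.mpr h4)]

/-- A closed subspace with a frame of integer translates of `φ` is closed under periodic Fourier
multipliers of `φ`. -/
theorem mem_of_fourier_eq_mul {W : Submodule ℂ L2R} (hW : IsClosed (W : Set L2R)) {φ : L2R}
    (hφ : IsFrame W fun k : ℤ => translate k φ) {f : L2R} {m : ℝ → ℂ}
    (hm : Function.Periodic m 1)
    (h : (𝓕 f : L2R) =ᵐ[volume] fun γ => m γ * (𝓕 φ : L2R) γ) : f ∈ W := by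
  have : CompleteSpace W := hW.completeSpace_coe
  obtain ⟨B, hB⟩ := exists_periodization_le_of_isBessel (hφ.isBessel hW)
  rw [← W.orthogonal_orthogonal, Submodule.mem_orthogonal]
  intro g hg
  -- Orthogonality to all translates kills every Fourier coefficient of the bracket; then `m` may be
  -- unbounded.
  have h0 : bracket g φ =ᵐ[unitVol] 0 := by
    refine ae_eq_zero_of_unitCoeff_eq_zero (memLp_bracket hB g) fun k => ?_
    rw [← inner_translate]
    exact (Submodule.mem_orthogonal W g).mp hg _ (hφ.mem k)
  rw [← integral_bracket]
  refine integral_eq_zero_of_ae ?_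
  filter_upwards [h0, bracket_of_fourier_eq_mul hm h g] with γ h1 h2
  rw [h2, ← bracket_conj, h1]
  simp

theorem exists_periodic_of_mem_span {φ f : L2R}
    (hf : f ∈ Submodule.span ℂ (Set.range fun k : ℤ => translate k φ)) :
    ∃ p : ℝ → ℂ, Function.Periodic p 1 ∧
      (𝓕 f : L2R) =ᵐ[volume] fun γ => p γ * (𝓕 φ : L2R) γ := by
  induction hf using Submodule.span_induction with
  | mem x hx =>
    obtain ⟨k, rfl⟩ := hx
    exact ⟨_, periodic_expChar (-k), fourier_translate k φ⟩
  | zero =>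
    refine ⟨0, fun _ => rfl, ?_⟩
    rw [FourierTransform.fourier_zero]
    filter_upwards [Lp.coeFn_zero ℂ 2 (volume : Measure ℝ)] with γ h
    rw [h]
    simp
  | add x y _ _ hx hy =>
    obtain ⟨p, hp, h1⟩ := hx
    obtain ⟨q, hq, h2⟩ := hy
    refine ⟨p + q, hp.add hq, ?_⟩
    rw [FourierTransform.fourier_add]
    filter_upwards [h1, h2, Lp.coeFn_add (𝓕 x : L2R) (𝓕 y)] with γ h1 h2 h3
    rw [h3, Pi.add_apply, h1, h2, Pi.add_apply, add_mul]
  | smul c x _ hx =>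
    obtain ⟨p, hp, h1⟩ := hx
    refine ⟨c • p, hp.smul c, ?_⟩
    rw [FourierTransform.fourier_smul]
    filter_upwards [h1, Lp.coeFn_smul c (𝓕 x : L2R)] with γ h1 h3
    rw [h3, Pi.smul_apply, h1, Pi.smul_apply, smul_mul_assoc]

/-- If `H = V ⊕ Wᗮ`, the periodization of a generator of `V` is dominated by the squared bracket
with a generator of `W`. -/
theorem exists_periodization_le_sq_bracket {W V : Submodule ℂ L2R}
    (hW : IsClosed (W : Set L2R)) (hV : IsClosed (V : Set L2R)) (h : IsCompl V Wᗮ) {φ φ₁ : L2R}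
    (hφ : IsFrame W fun k : ℤ => translate k φ) (hφ₁ : IsFrame V fun k : ℤ => translate k φ₁) :
    ∃ C : ℝ, 0 ≤ C ∧ ∀ᵐ γ ∂unitVol, periodization φ₁ γ ≤ C * ‖bracket φ φ₁ γ‖ ^ 2 := by
  obtain ⟨C, hC0, hC⟩ := hφ.exists_sq_norm_le_of_isCompl hW hV h
  obtain ⟨B, hB⟩ := exists_periodization_le_of_isBessel (hφ.isBessel hW)
  refine ⟨C, hC0, ?_⟩
  have hsym : ∀ γ, ‖bracket φ φ₁ γ‖ = ‖bracket φ₁ φ γ‖ := fun γ => by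
    rw [← bracket_conj, RCLike.norm_conj]
  simp only [hsym]
  refine ae_le_of_forall_setIntegral_le (integrable_periodization φ₁)
    ((memLp_bracket hB φ₁).norm.integrable_sq.const_mul C) fun s hs _ => ?_
  -- Testing the norm inequality on cutoffs of `φ₁` to arbitrary measurable sets localizes it to a
  -- pointwise one.
  obtain ⟨v, m, hmp, hv, hms⟩ := exists_fourier_eq_indicator_mul hs φ₁
  have h1 := hC v (mem_of_fourier_eq_mul hV hφ₁ hmp hv)
  rw [(hasSum_sq_inner_translate (memLp_bracket hB v)).tsum_eq, ← integral_periodization,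
    ← integral_const_mul] at h1
  rw [← integral_indicator hs, ← integral_indicator hs]
  convert h1 using 1
  · apply integral_congr_ae
    filter_upwards [periodization_of_fourier_eq_mul hmp hv, hms] with γ h1 h2
    rw [h1, h2]
    by_cases hγ : γ ∈ s <;> simp [hγ]
  · apply integral_congr_ae
    filter_upwards [bracket_of_fourier_eq_mul hmp hv φ, hms] with γ h1 h2
    rw [h1, h2]
    by_cases hγ : γ ∈ s <;> simp [hγ]

theorem integral_sqrt_periodization_mul_le (f g : L2R) :
    ∫ γ, √(periodization f γ) * √(periodization g γ) ∂unitVol ≤ ‖f‖ * ‖g‖ := by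
  have hmem : ∀ f : L2R, MemLp (fun γ => √(periodization f γ)) (ENNReal.ofReal 2) unitVol := by
    intro f
    rw [ENNReal.ofReal_ofNat, memLp_two_iff_integrable_sq
      (measurable_periodization f).sqrt.aestronglyMeasurable]
    simpa only [Real.sq_sqrt (periodization_nonneg f _)] using integrable_periodization f
  have := integral_mul_le_Lp_mul_Lq_of_nonneg Real.HolderConjugate.two_two
    (ae_of_all unitVol fun γ => Real.sqrt_nonneg (periodization f γ))
    (ae_of_all unitVol fun γ => Real.sqrt_nonneg (periodization g γ)) (hmem f) (hmem g)
  refine this.trans_eq ?_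
  simp only [Real.rpow_ofNat, Real.sq_sqrt (periodization_nonneg _ _), integral_periodization,
    ← Real.sqrt_eq_rpow, Real.sqrt_sq (norm_nonneg _)]

/-- Composing analysis with the translates of `φt` and synthesis with the translates of `φ`
multiplies Fourier transforms by `conj H · [φ̂, φ̂₁]`; if this function is within `δ` of one, the
composition is within `δ` of the identity on `W`. -/
theorem norm_sub_synthesis_analysis_le {W : Submodule ℂ L2R} (hW : IsClosed (W : Set L2R))
    {φ φ₁ φt : L2R} (hφ : IsFrame W fun k : ℤ => translate k φ)
    (hg : IsBessel fun k : ℤ => translate k φt)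
    {Ht : ℝ → ℂ} (hHp : Function.Periodic Ht 1)
    (hHt : (𝓕 φt : L2R) =ᵐ[volume] fun γ => Ht γ * (𝓕 φ₁ : L2R) γ) {δ : ℝ} (hδ : 0 ≤ δ)
    (hb : ∀ᵐ γ ∂unitVol, periodization φ γ ≠ 0 →
      ‖starRingEnd ℂ (Ht γ) * bracket φ φ₁ γ - 1‖ ≤ δ) {w : L2R} (hw : w ∈ W) :
    ‖w - synthesis _ (hφ.isBessel hW) (analysis _ hg w)‖ ≤ δ * ‖w‖ := by
  have hf := hφ.isBessel hW
  obtain ⟨B, hB⟩ := exists_periodization_le_of_isBessel hf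
  obtain ⟨B', hB'⟩ := exists_periodization_le_of_isBessel hg
  have hclosed : IsClosed {w : L2R |
      ‖w - synthesis _ (hφ.isBessel hW) (analysis _ hg w)‖ ≤ δ * ‖w‖} :=
    isClosed_le (by fun_prop) (by fun_prop)
  refine closure_minimal ?_ hclosed (hφ.le_topologicalClosure_span hW hw)
  intro f hfs
  obtain ⟨p, hp, hpf⟩ := exists_periodic_of_mem_span hfs
  rw [Set.mem_ofPred_eq]
  set y := f - synthesis _ (hφ.isBessel hW) (analysis _ hg f) with hy
  -- The error is estimated weakly, so only inner products with the synthesized vector are needed;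
  -- `u = y` then gives the norm.
  have key : ∀ u : L2R, ‖⟪u, y⟫_ℂ‖ ≤ δ * (‖u‖ * ‖f‖) := by
    intro u
    have h1 : ⟪u, y⟫_ℂ = ∫ γ, (bracket f u γ
        - starRingEnd ℂ (bracket u φ γ) * bracket f φt γ) ∂unitVol := by
      have hint : Integrable (fun γ => starRingEnd ℂ (bracket u φ γ) * bracket f φt γ) unitVol :=
        (memLp_bracket hB u).star.integrable_mul (memLp_bracket hB' f)
      rw [integral_sub (integrable_bracket f u) hint, integral_bracket, hy, inner_sub_right,
        inner_synthesis_analysis]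
      simp only [inner_translate]
      rw [(hasSum_unitCoeff_mul (memLp_bracket hB u) (memLp_bracket hB' f)).tsum_eq]
    have hpos : ∀ᵐ γ ∂unitVol, ‖bracket f u γ
        - starRingEnd ℂ (bracket u φ γ) * bracket f φt γ‖
        ≤ δ * (√(periodization u γ) * √(periodization f γ)) := by
      filter_upwards [hb, bracket_of_fourier_eq_mul hp hpf u, bracket_of_fourier_eq_mul hp hpf φ₁,
        bracket_of_fourier_eq_mul_right hHp hHt f, periodization_of_fourier_eq_mul hp hpf,
        norm_bracket_le u φ] with γ e1 e2 e3 e4 e5 e6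
      have e7 : bracket f u γ - starRingEnd ℂ (bracket u φ γ) * bracket f φt γ
          = -(p γ * starRingEnd ℂ (bracket u φ γ)
            * (starRingEnd ℂ (Ht γ) * bracket φ φ₁ γ - 1)) := by
        rw [e2, e4, e3, bracket_conj]
        ring
      rw [e7, norm_neg, norm_mul, norm_mul, RCLike.norm_conj, e5,
        Real.sqrt_mul (sq_nonneg _), Real.sqrt_sq (norm_nonneg _)]
      -- The hypothesis is silent where `Φ = 0`, but there `[u, φ]` vanishes by Cauchy–Schwarz.
      by_cases h0 : periodization φ γ = 0
      · rw [h0, Real.sqrt_zero, mul_zero] at e6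
        rw [le_antisymm e6 (norm_nonneg _), h0]
        simp
      · calc ‖p γ‖ * ‖bracket u φ γ‖ * ‖starRingEnd ℂ (Ht γ) * bracket φ φ₁ γ - 1‖
            ≤ ‖p γ‖ * (√(periodization u γ) * √(periodization φ γ)) * δ := by
              gcongr
              exact e1 h0
          _ = _ := by ring
    rw [h1]
    have hint' : Integrable (fun γ => √(periodization u γ) * √(periodization f γ)) unitVol := by
      refine ((integrable_periodization u).add (integrable_periodization f)).mono'
        ((measurable_periodization u).sqrt.mul
          (measurable_periodization f).sqrt).aestronglyMeasurable (ae_of_all _ fun γ => ?_)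
      rw [Real.norm_of_nonneg (by positivity), Pi.add_apply]
      nlinarith [Real.sq_sqrt (periodization_nonneg u γ), Real.sq_sqrt (periodization_nonneg f γ),
        sq_nonneg (√(periodization u γ) - √(periodization f γ)),
        mul_nonneg (Real.sqrt_nonneg (periodization u γ)) (Real.sqrt_nonneg (periodization f γ))]
    refine (norm_integral_le_of_norm_le (hint'.const_mul δ) hpos).trans ?_
    rw [integral_const_mul]
    exact mul_le_mul_of_nonneg_left (integral_sqrt_periodization_mul_le u f) hδ
  have hyy := key y
  rw [inner_self_eq_norm_sq_to_K] at hyy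
  rcases (norm_nonneg y).eq_or_lt with h0 | h0
  · rw [← h0]; positivity
  · have : ‖y‖ * ‖y‖ ≤ ‖y‖ * (δ * ‖f‖) := by
      have e : ‖((‖y‖ : ℂ)) ^ 2‖ = ‖y‖ * ‖y‖ := by simp [sq]
      calc ‖y‖ * ‖y‖ = _ := e.symm
        _ ≤ _ := hyy
        _ = _ := by ring
    exact le_of_mul_le_mul_left this h0

theorem translate_mem {W : Submodule ℂ L2R} (hW : IsClosed (W : Set L2R)) {φ f : L2R}
    (hφ : IsFrame W fun k : ℤ => translate k φ) {m : ℝ → ℂ} (hm : Function.Periodic m 1)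
    (h : (𝓕 f : L2R) =ᵐ[volume] fun γ => m γ * (𝓕 φ : L2R) γ) (k : ℤ) : translate k f ∈ W := by
  refine mem_of_fourier_eq_mul hW hφ ((periodic_expChar (-k)).mul hm) ?_
  filter_upwards [h, fourier_translate k f] with γ h1 h2
  rw [h2, h1, Pi.mul_apply, mul_assoc]

end Translates

end ObliqueFrames

end

/-! ### The approximate duality theorem. -/

theorem mainTheorem6
    (W V : Submodule ℂ ObliqueFrames.L2R)
    (hW : IsClosed (W : Set ObliqueFrames.L2R)) (hV : IsClosed (V : Set ObliqueFrames.L2R))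
    (hWV : IsCompl W Vᗮ)
    (φ φ₁ φt : ObliqueFrames.L2R)
    (hφ : ObliqueFrames.IsFrame W (fun k : ℤ => ObliqueFrames.translate k φ))
    (hφ₁ : ObliqueFrames.IsFrame V (fun k : ℤ => ObliqueFrames.translate k φ₁))
    (hφt : φt ∈ V)
    (Ht : ℝ → ℂ) (hHt_per : Function.Periodic Ht 1)
    (hHt_L2 : MemLp Ht 2 (volume.restrict (Set.Ioo (0 : ℝ) 1)))
    (hHt : ∀ᵐ γ : ℝ, (𝓕 φt : ObliqueFrames.L2R) γ = Ht γ * (𝓕 φ₁ : ObliqueFrames.L2R) γ)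
    (ε : ℝ) (hε0 : 0 ≤ ε) (hε1 : ε < 1)
    (hbound : ∀ᵐ γ ∂(volume.restrict (Set.Icc (0 : ℝ) 1)),
      ObliqueFrames.periodization φ γ ≠ 0 →
        ‖starRingEnd ℂ (Ht γ) * ObliqueFrames.bracket φ φ₁ γ - 1‖
          ≤ ε / ‖ObliqueFrames.obliqueProj W V hW hWV‖) :
    ObliqueFrames.IsFrame V (fun k : ℤ => ObliqueFrames.translate k φt) ∧
      ObliqueFrames.IsApproxObliqueDual W V hW hV hWV ε
        (fun k : ℤ => ObliqueFrames.translate k φ)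
        (fun k : ℤ => ObliqueFrames.translate k φt) := by

  open ObliqueFrames in
  set δ := ε / ‖obliqueProj W V hW hWV‖ with hδ
  have hδ0 : 0 ≤ δ := by positivity
  have hb : ∀ᵐ γ ∂unitVol, periodization φ γ ≠ 0 →
      ‖starRingEnd ℂ (Ht γ) * bracket φ φ₁ γ - 1‖ ≤ δ :=
    ae_restrict_of_ae_restrict_of_subset Set.Ioc_subset_Icc_self hbound
  obtain ⟨C, hC0, hC⟩ :=
    exists_periodization_le_sq_bracket hW hV (isCompl_swap hW hV hWV) hφ hφ₁
  -- `δ + 1` bounds `|H̃ [φ, φ₁]|`: by the triangle inequality where `Φ ≠ 0`, and trivially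
  -- elsewhere, where the bracket vanishes.
  have hΦt : ∀ᵐ γ ∂unitVol, periodization φt γ ≤ C * (δ + 1) ^ 2 := by
    filter_upwards [hb, hC, periodization_of_fourier_eq_mul hHt_per hHt,
      norm_bracket_le φ φ₁] with γ h1 h2 h3 h4
    have h5 : ‖starRingEnd ℂ (Ht γ) * bracket φ φ₁ γ‖ ≤ δ + 1 := by
      by_cases h0 : periodization φ γ = 0
      · rw [h0, Real.sqrt_zero, zero_mul] at h4
        rw [norm_mul, le_antisymm h4 (norm_nonneg _), mul_zero]
        positivity
      · have := norm_le_norm_sub_add (starRingEnd ℂ (Ht γ) * bracket φ φ₁ γ) 1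
        rw [norm_one] at this
        linarith [h1 h0]
    calc periodization φt γ ≤ ‖Ht γ‖ ^ 2 * (C * ‖bracket φ φ₁ γ‖ ^ 2) := by rw [h3]; gcongr
      _ = C * ‖starRingEnd ℂ (Ht γ) * bracket φ φ₁ γ‖ ^ 2 := by
        rw [norm_mul, RCLike.norm_conj]; ring
      _ ≤ _ := by gcongr
  have hg := isBessel_of_periodization_le hΦt
  have hgV := translate_mem hV hφ₁ hHt_per hHt
  have hest := norm_obliqueProj_sub_le hW hWV (hφ.isBessel hW) hg hgV hε0 fun w hw =>
    norm_sub_synthesis_analysis_le hW hφ hg hHt_per hHt hδ0 hb hw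
  have hframe := isFrame_of_norm_obliqueProj_sub_le hW hWV (hφ.isBessel hW) hg hgV hε1 hest
  exact ⟨hframe, hφ, hframe, Or.inl hest⟩
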